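/- Let $\mathcal G$ be a connected undirected simple graph on the agents $[n]$, and let $W$ be an $n\times n$ matrix of nonnegative weights with $W_{ij}>0$ if and only if $\{i,j\}$ is an edge of $\mathcal G$. Let $A$ be the diagonal matrix with $A_{ii}=\sum_j W_{ij}$ and suppose $A_{ii}\le 1$ for all $i$; if $\mathcal G$ is bipartite, suppose also that $A_{ii}<1$ for at least one $i$. Each agent $i$ has an initial sample $X_i\in[M]$; let $\Pi\in\mathbb R^M$ be the row vector $\Pi(m)=\frac1n|\{i: X_i=m\}|$, let $\mathbf e_m\in\mathbb R^M$ be the $m$-th elementary row vector, and let $\mathbf 1\in\mathbb R^n$ be the all-ones column vector. Let $\mathbf Q(t)$ and $\mathbf Y(t)$, $t=0,1,2,\ldots$, be random $n\times M$ matrices with rows $Q_i(t)$ and $Y_i(t)$ such that $Q_i(0)=\mathbf e_{X_i}$, $$\mathbf Q(t+1)=(I-A)\,\mathbf Q(t)+W\,\mathbf Y(t),$$ every message $Y_i(t)$ lies in $\{\mathbf 0,\mathbf e_1,\ldots,\mathbf e_M\}$, and, conditionally on $\mathbf Q(0),\ldots,\mathbf Q(t)$, the messages $Y_1(t),\ldots,Y_n(t)$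 are independent with $\mathbb P(Y_i(t)=\mathbf e_m\mid \mathbf Q(0),\ldots,\mathbf Q(t))=Q_{i,m}(t)$ for all $m\in[M]$ (that is, $\mathbf P(t)=\mathbf Q(t)$). Then there is a random vector $\mathbf q^*$ with values in $\{\mathbf e_1,\ldots,\mathbf e_M\}$ such that $\mathbf Q(t)\to\mathbf Q^*:=\mathbf 1\mathbf q^*$ almost surely. If, moreover, $\sum_i W_{ij}=A_{jj}$ for every $j$ (in particular, if $W$ is symmetric, so that $A-W$ is the Laplacian of an undirected weighted graph), then $\mathbb E[\mathbf Q^*]=\mathbf 1\Pi$. -/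

import Mathlib

open MeasureTheory ProbabilityTheory Filter Topology

noncomputable section

namespace SocialSampling

/-- The vector of a message: `none` is the silent message `0`, and `some m` is the elementary
vector `e_m`. The range of this map is the message alphabet `{0, e_1, …, e_M}`. -/
def msgVec {M : ℕ} : Option (Fin M) → Fin M → ℝ
  | none => 0
  | some m => Pi.single m 1

/-- The probability of each message under a row vector `p` with `p m = P(message = e_m)`;
the remaining mass is that of the silent message. -/
def msgProb {M : ℕ} (p : Fin M → ℝ) : Option (Fin M) → ℝ
  | none => 1 - ∑ m, p m
  | some m => p m

/-- The empirical distribution `Π` of the initial samples. -/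
def empirical {n M : ℕ} (X : Fin n → Fin M) (m : Fin M) : ℝ :=
  (1 / (n : ℝ)) * ∑ i, if X i = m then (1 : ℝ) else 0

/-- The rank-one matrix `1 q` all of whose rows are equal to `q`. -/
def consensus (n : ℕ) {M : ℕ} (q : Fin M → ℝ) : Matrix (Fin n) (Fin M) ℝ :=
  Matrix.of fun _ m => q m

/-- The σ-algebra generated by the estimates up to and including time `t`. -/
abbrev history {n M : ℕ} {Ω : Type*} (Q : ℕ → Ω → Matrix (Fin n) (Fin M) ℝ) (t : ℕ) :
    MeasurableSpace Ω :=
  ⨆ s : Fin (t + 1), MeasurableSpace.comap (fun ω i m => Q s ω i m)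
    (inferInstance : MeasurableSpace (Fin n → Fin M → ℝ))

/-- `Y` is a sequence of social samples drawn from the distributions `P`: the rows `Y_i(t)` are
random messages and, conditionally on the history of the estimates up to time `t`, they are
independent over the agents `i`, with `Y_i(t)` distributed according to `P_i(t)`. -/
structure IsSocialSample {n M : ℕ} {Ω : Type*} [MeasurableSpace Ω] (μ : Measure Ω)
    (Q P Y : ℕ → Ω → Matrix (Fin n) (Fin M) ℝ) : Prop where
  measurable : ∀ t i m, Measurable fun ω => Y t ω i m
  mem_alphabet : ∀ t ω i, Y t ω i ∈ Set.range (msgVec (M := M))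
  law : ∀ (t : ℕ) (v : Fin n → Option (Fin M)),
    μ⟦{ω | ∀ i, Y t ω i = msgVec (v i)} | history Q t⟧ =ᵐ[μ]
      fun ω => ∏ i, msgProb (P t ω i) (v i)

/-- Averaging with social samples: the initial estimates are `Q_i(0) = e_{X_i}`, the messages are
sampled from `P(t) = Q(t)`, and `Q(t+1) = (I - A) Q(t) + W Y(t)`. -/
structure IsAveraging {n M : ℕ} {Ω : Type*} [MeasurableSpace Ω] (μ : Measure Ω)
    (A W : Matrix (Fin n) (Fin n) ℝ) (X : Fin n → Fin M)
    (Q Y : ℕ → Ω → Matrix (Fin n) (Fin M) ℝ) : Prop where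
  init : ∀ ω i, Q 0 ω i = Pi.single (X i) 1
  sample : IsSocialSample μ Q Q Y
  update : ∀ t ω, Q (t + 1) ω = (1 - A) * Q t ω + W * Y t ω

end SocialSampling

end

/-!
Write `H = 1 - A + W`, a row-stochastic matrix. As `G` is connected, `H` has a positive stationary
vector `p`. For each `m`, the weighted average `p ⬝ᵥ Q(t)_m` changes at time `t` by the linear
combination, with coefficients `(p ᵥ* W) j`, of the deviations `Y_{j,m}(t) - Q_{j,m}(t)`, which are
centred, uncorrelated, and uncorrelated with the past. So its variance grows at each step by
`∑ j, (p ᵥ* W) j ^ 2 * Var(Y_{j,m}(t) - Q_{j,m}(t))`; being bounded, it forces the variances of the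
deviations to be summable, and `Y(t) - Q(t) → 0` almost surely.

Since `Y(t)` takes finitely many values and `Y(t + 1) - H * Y(t) → 0`, eventually
`Y(t + 1) = H * Y(t)` holds exactly. A column `y` of `Y(t)` is then a `0`-`1` vector with a `0`-`1`
image `H *ᵥ y`; an average of zeros and ones is `0` or `1` only if its terms agree, so `y` is
constant on the neighbours of each vertex. A vertex that has the same value as its neighbours, which
exists when `G` is not bipartite or `H` has a positive diagonal entry, propagates this to all of
`G`. Consensus, once reached, is preserved by `H`.

The mean obeys `E[Q(t + 1)] = H * E[Q(t)]`. Row sums are preserved, so no mass escapes to the silent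
message; column sums are preserved when the weights are balanced, which identifies `E[Q^*]`.
-/

namespace SocialSampling

open scoped Matrix

/-! ### Binary vectors and row-stochastic matrices -/

section Graph

variable {V α : Type*} {G : SimpleGraph V}

theorem forall_of_preconnected_of_adj (hG : G.Preconnected) {P : V → Prop}
    (hP : ∀ ⦃u v⦄, G.Adj u v → P u → P v) {u : V} (hu : P u) (v : V) : P v := by
  obtain ⟨w⟩ := hG u v
  induction w with
  | nil => exact hu
  | cons hadj _ ih => exact ih (hP hadj hu)

theorem eq_of_forall_common_neighbor (hG : G.Preconnected) {y : V → α}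
    (hcommon : ∀ ⦃i j k⦄, G.Adj i j → G.Adj i k → y j = y k)
    {i : V} (hi : ∀ j, G.Adj i j → y j = y i) (u v : V) : y u = y v := by
  have hadj : ∀ a b, G.Adj a b → y b = y a :=
    forall_of_preconnected_of_adj hG (P := fun a => ∀ b, G.Adj a b → y b = y a)
      (fun a b hab ha c hbc => (hcommon hbc hab.symm).trans (ha b hab).symm) hi
  exact (forall_of_preconnected_of_adj hG (P := fun a => y a = y u)
    (fun a b hab ha => (hadj a b hab).trans ha) rfl v).symm

theorem exists_adj_eq_of_not_isBipartite (hG : ¬ G.IsBipartite) {y : V → α} {a b : α}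
    (hy : ∀ v, y v = a ∨ y v = b) : ∃ u v, G.Adj u v ∧ y u = y v := by
  classical
  by_contra! hne
  refine hG ⟨SimpleGraph.Coloring.mk (fun v => if y v = a then (0 : Fin 2) else 1) ?_⟩
  intro u v huv
  have := hne u v huv
  rcases hy u with hu | hu <;> rcases hy v with hv | hv <;> simp_all [eq_comm]

end Graph

section Algebra

theorem exists_eq_single_of_binary_of_sum_eq_one {ι R : Type*} [Fintype ι] [DecidableEq ι]
    [Semiring R] [PartialOrder R] [IsStrictOrderedRing R] {b : ι → R}
    (hb : ∀ i, b i = 0 ∨ b i = 1) (hsum : ∑ i, b i = 1) : ∃ k, b = Pi.single k 1 := by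
  obtain ⟨k, -, hk⟩ := Finset.exists_ne_zero_of_sum_ne_zero (hsum.trans_ne one_ne_zero)
  have hle : ∀ i ∈ Finset.univ, (Pi.single k 1 : ι → R) i ≤ b i := fun i _ => by
    rcases eq_or_ne i k with rfl | hik
    · rw [Pi.single_eq_same, (hb i).resolve_left hk]
    · rw [Pi.single_eq_of_ne hik]
      rcases hb i with hi | hi <;> simp [hi]
  have heq := (Finset.sum_eq_sum_iff_of_le hle).1 (by simp [hsum])
  exact ⟨k, funext fun i => (heq i (Finset.mem_univ i)).symm⟩

theorem dotProduct_mulVec_add_mulVec {ι R : Type*} [Fintype ι] [CommRing R] {B W : Matrix ι ι R}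
    {p : ι → R} (hp : p ᵥ* (B + W) = p) (x y : ι → R) :
    p ⬝ᵥ (B *ᵥ x + W *ᵥ y) = p ⬝ᵥ x + (p ᵥ* W) ⬝ᵥ (y - x) :=
  calc p ⬝ᵥ (B *ᵥ x + W *ᵥ y) = p ⬝ᵥ ((B + W) *ᵥ x + W *ᵥ (y - x)) := by
        rw [Matrix.add_mulVec, Matrix.mulVec_sub, add_add_sub_cancel]
    _ = p ⬝ᵥ x + (p ᵥ* W) ⬝ᵥ (y - x) := by
        rw [dotProduct_add, Matrix.dotProduct_mulVec, Matrix.dotProduct_mulVec, hp]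

theorem one_vecMul_one_sub_add_of_balanced {ι R : Type*} [Fintype ι] [DecidableEq ι] [CommRing R]
    {A W : Matrix ι ι R} (hA : A.IsDiag) (hbal : ∀ j, ∑ i, W i j = A j j) :
    1 ᵥ* (1 - A + W) = 1 := by
  funext j
  have hA_col : ∑ i, A i j = A j j :=
    Finset.sum_eq_single_of_mem j (Finset.mem_univ j) fun i _ hij => hA hij
  simp [Matrix.vecMul, dotProduct, Finset.sum_add_distrib, Finset.sum_sub_distrib,
    Matrix.one_apply, hA_col, hbal]

end Algebra

section RowStochastic

theorem mulVec_const_of_mem_rowStochastic {ι R : Type*} [Fintype ι] [DecidableEq ι]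
    [Semiring R] [PartialOrder R] [IsOrderedRing R] {H : Matrix ι ι R}
    (hH : H ∈ Matrix.rowStochastic R ι) (c : R) :
    (H *ᵥ fun _ => c) = fun _ => c := by
  funext i
  simp only [Matrix.mulVec, dotProduct, ← Finset.sum_mul,
    Matrix.sum_row_of_mem_rowStochastic hH, one_mul]

theorem pos_of_vecMul_eq {ι R : Type*} [Fintype ι] [Semiring R] [PartialOrder R]
    [IsStrictOrderedRing R] {G : SimpleGraph ι} {H : Matrix ι ι R} {p : ι → R}
    (hG : G.Preconnected) (hH : ∀ i j, 0 ≤ H i j)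
    (hpos : ∀ ⦃i j⦄, G.Adj i j → 0 < H i j) (hp : ∀ i, 0 ≤ p i) (hp_ne : p ≠ 0)
    (hpH : p ᵥ* H = p) (i : ι) : 0 < p i := by
  obtain ⟨k, hk⟩ := Function.ne_iff.1 hp_ne
  refine forall_of_preconnected_of_adj hG (P := fun i => 0 < p i) (fun u v huv hu => ?_)
    ((hp k).lt_of_ne' hk) i
  have hsum : 0 < ∑ l, p l * H l v :=
    Finset.sum_pos' (fun l _ => mul_nonneg (hp l) (hH l v))
      ⟨u, Finset.mem_univ u, mul_pos hu (hpos huv)⟩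
  exact hsum.trans_eq (congrFun hpH v)

variable {ι R : Type*} [Fintype ι] [DecidableEq ι] [CommRing R] [LinearOrder R]
  [IsStrictOrderedRing R] {G : SimpleGraph ι} {H : Matrix ι ι R} {y : ι → R}

theorem apply_eq_mulVec_of_forall_le (hH : H ∈ Matrix.rowStochastic R ι) {i j : ι}
    (hle : ∀ k, y k ≤ (H *ᵥ y) i) (hij : 0 < H i j) : y j = (H *ᵥ y) i := by
  have hnonneg : ∀ k ∈ Finset.univ, 0 ≤ H i k * ((H *ᵥ y) i - y k) := fun k _ =>
    mul_nonneg (Matrix.nonneg_of_mem_rowStochastic hH) (sub_nonneg.2 (hle k))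
  have hsum : ∑ k, H i k * ((H *ᵥ y) i - y k) = 0 := by
    simp only [mul_sub, Finset.sum_sub_distrib, ← Finset.sum_mul,
      Matrix.sum_row_of_mem_rowStochastic hH, one_mul]
    exact sub_self _
  have hzero := (Finset.sum_eq_zero_iff_of_nonneg hnonneg).1 hsum j (Finset.mem_univ j)
  exact (sub_eq_zero.1 ((mul_eq_zero.1 hzero).resolve_left hij.ne')).symm

theorem apply_eq_mulVec_of_binary (hH : H ∈ Matrix.rowStochastic R ι)
    (hy : ∀ k, y k = 0 ∨ y k = 1) {i j : ι} (hi : (H *ᵥ y) i = 0 ∨ (H *ᵥ y) i = 1)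
    (hij : 0 < H i j) : y j = (H *ᵥ y) i := by
  rcases hi with hi | hi
  · have hneg : (-y) j = (H *ᵥ -y) i := by
      refine apply_eq_mulVec_of_forall_le hH (fun k => ?_) hij
      rcases hy k with hk | hk <;> simp [Matrix.mulVec_neg, hi, hk]
    simpa [Matrix.mulVec_neg] using hneg
  · refine apply_eq_mulVec_of_forall_le hH (fun k => ?_) hij
    rcases hy k with hk | hk <;> simp [hi, hk]

theorem exists_nonneg_vecMul_eq [Nonempty ι] (hH : H ∈ Matrix.rowStochastic R ι) :
    ∃ p : ι → R, (∀ i, 0 ≤ p i) ∧ p ≠ 0 ∧ p ᵥ* H = p := by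
  have hdet : (H - 1).det = 0 := Matrix.exists_mulVec_eq_zero_iff.1
    ⟨1, one_ne_zero, by
      rw [Matrix.sub_mulVec, Matrix.one_vecMul_of_mem_rowStochastic hH, Matrix.one_mulVec,
        sub_self]⟩
  obtain ⟨v, hv_ne, hv⟩ := Matrix.exists_vecMul_eq_zero_iff.2 hdet
  rw [Matrix.vecMul_sub, Matrix.vecMul_one, sub_eq_zero] at hv
  have habs_le : ∀ j ∈ Finset.univ, |v j| ≤ ∑ i, |v i| * H i j := fun j _ =>
    calc |v j| = |∑ i, v i * H i j| := congrArg abs (congrFun hv j).symm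
      _ ≤ ∑ i, |v i * H i j| := Finset.abs_sum_le_sum_abs _ _
      _ = ∑ i, |v i| * H i j := by
        simp only [abs_mul, abs_of_nonneg (Matrix.nonneg_of_mem_rowStochastic hH)]
  have hsum : ∑ j, |v j| = ∑ j, ∑ i, |v i| * H i j := by
    rw [Finset.sum_comm]
    simp only [← Finset.mul_sum, Matrix.sum_row_of_mem_rowStochastic hH, mul_one]
  -- `|v| ≤ |v| ᵥ* H` entrywise, and both sides have the same total mass.
  refine ⟨|v|, fun i => abs_nonneg (v i),
    fun h => hv_ne (funext fun i => abs_eq_zero.1 (congrFun h i)), funext fun j => ?_⟩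
  exact ((Finset.sum_eq_sum_iff_of_le habs_le).1 hsum j (Finset.mem_univ j)).symm

theorem eq_of_mulVec_binary (hG : G.Preconnected) (hH : H ∈ Matrix.rowStochastic R ι)
    (hpos : ∀ ⦃i j⦄, G.Adj i j → 0 < H i j) (haper : ¬ G.IsBipartite ∨ ∃ i, 0 < H i i)
    (hy : ∀ i, y i = 0 ∨ y i = 1) (hHy : ∀ i, (H *ᵥ y) i = 0 ∨ (H *ᵥ y) i = 1) (u v : ι) :
    y u = y v := by
  have hnbr : ∀ ⦃i j⦄, 0 < H i j → y j = (H *ᵥ y) i := fun i _ =>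
    apply_eq_mulVec_of_binary hH hy (hHy i)
  have hcommon : ∀ ⦃i j k⦄, G.Adj i j → G.Adj i k → y j = y k := fun i j k hij hik =>
    (hnbr (hpos hij)).trans (hnbr (hpos hik)).symm
  rcases haper with hbip | ⟨i, hi⟩
  · obtain ⟨a, b, hab, hyab⟩ := exists_adj_eq_of_not_isBipartite hbip hy
    exact eq_of_forall_common_neighbor hG hcommon
      (fun c hac => (hcommon hac hab).trans hyab.symm) u v
  · exact eq_of_forall_common_neighbor hG hcommon
      (fun j hij => (hnbr (hpos hij)).trans (hnbr hi).symm) u v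

end RowStochastic

section Consensus

theorem eventually_eq_of_tendsto_of_finite_range {α β : Type*} [TopologicalSpace β] [T1Space β]
    {l : Filter α} {e : α → β} (he : (Set.range e).Finite) {b : β}
    (h : Tendsto e l (𝓝 b)) : ∀ᶠ t in l, e t = b := by
  have hopen : IsOpen (Set.range e \ {b})ᶜ := (he.subset Set.sdiff_subset).isClosed.isOpen_compl
  filter_upwards [h (hopen.mem_nhds (by simp))] with t ht
  by_contra hne
  exact ht ⟨Set.mem_range_self t, hne⟩

variable {ι : Type*} [Fintype ι] {B W : Matrix ι ι ℝ} {x y : ℕ → ι → ℝ}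

theorem eventually_eq_mulVec_of_tendsto_sub (hx : ∀ t, x (t + 1) = B *ᵥ x t + W *ᵥ y t)
    (hy : (Set.range y).Finite) (hlim : Tendsto (fun t => y t - x t) atTop (𝓝 0)) :
    ∀ᶠ t in atTop, y (t + 1) = (B + W) *ᵥ y t := by
  have hfin : (Set.range fun t => y (t + 1) - (B + W) *ᵥ y t).Finite :=
    (hy.image2 (fun u v => u - (B + W) *ᵥ v) hy).subset
      (Set.range_subset_iff.2 fun t => ⟨y (t + 1), ⟨t + 1, rfl⟩, y t, ⟨t, rfl⟩, rfl⟩)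
  have hcont : Continuous fun v => B *ᵥ v := continuous_const.matrix_mulVec continuous_id
  have herr : Tendsto (fun t => y (t + 1) - (B + W) *ᵥ y t) atTop (𝓝 0) := by
    have hdiff := (hlim.comp (tendsto_add_atTop_nat 1)).sub ((hcont.tendsto 0).comp hlim)
    simp only [Matrix.mulVec_zero, sub_zero] at hdiff
    refine hdiff.congr fun t => ?_
    simp only [Function.comp_apply, hx, Matrix.add_mulVec, Matrix.mulVec_sub]
    abel
  filter_upwards [eventually_eq_of_tendsto_of_finite_range hfin herr] with t ht
  exact sub_eq_zero.1 ht

theorem exists_tendsto_const_of_binary [DecidableEq ι] {G : SimpleGraph ι} (hG : G.Connected)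
    (hH : B + W ∈ Matrix.rowStochastic ℝ ι) (hpos : ∀ ⦃i j⦄, G.Adj i j → 0 < (B + W) i j)
    (haper : ¬ G.IsBipartite ∨ ∃ i, 0 < (B + W) i i)
    (hx : ∀ t, x (t + 1) = B *ᵥ x t + W *ᵥ y t) (hy : ∀ t i, y t i = 0 ∨ y t i = 1)
    (hlim : Tendsto (fun t => y t - x t) atTop (𝓝 0)) :
    ∃ b : ℝ, (b = 0 ∨ b = 1) ∧ Tendsto x atTop (𝓝 fun _ => b) := by
  have hfin : (Set.range y).Finite :=
    (Set.Finite.pi fun _ : ι => Set.toFinite ({0, 1} : Set ℝ)).subset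
      (Set.range_subset_iff.2 fun t i _ => hy t i)
  obtain ⟨T, hT⟩ := eventually_atTop.1 (eventually_eq_mulVec_of_tendsto_sub hx hfin hlim)
  obtain ⟨i₀⟩ := hG.nonempty
  have hconst : ∀ t ≥ T, y t = fun _ => y t i₀ := fun t ht => funext fun i =>
    eq_of_mulVec_binary hG.preconnected hH hpos haper (hy t)
      (fun j => hT t ht ▸ hy (t + 1) j) i i₀
  have hstable : ∀ t ≥ T, y t = fun _ => y T i₀ := fun t ht => by
    induction t, ht using Nat.le_induction with
    | base => exact hconst T le_rfl
    | succ t ht ih => rw [hT t ht, ih, mulVec_const_of_mem_rowStochastic hH]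
  refine ⟨y T i₀, hy T i₀, ?_⟩
  have hsub := hlim.const_sub fun _ => y T i₀
  rw [sub_zero] at hsub
  refine hsub.congr' ?_
  filter_upwards [eventually_ge_atTop T] with t ht
  rw [← hstable t ht, sub_sub_cancel]

end Consensus

/-! ### Variances and almost sure limits -/

section Probability

variable {Ω : Type*} {m mΩ : MeasurableSpace Ω} {μ : Measure Ω}

theorem covariance_eq_of_condExp_ae_eq [IsProbabilityMeasure μ] (hm : m ≤ mΩ) {f g p : Ω → ℝ}
    (hf_meas : AEStronglyMeasurable[m] f μ) (hf : MemLp f 2 μ) (hg : MemLp g 2 μ)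
    (hp : μ[g | m] =ᵐ[μ] p) : cov[f, g; μ] = cov[f, p; μ] := by
  have hpL2 : MemLp p 2 μ := (hg.condExp one_le_two).ae_eq hp
  have hpull : μ[f * g | m] =ᵐ[μ] f * p :=
    (condExp_mul_of_aestronglyMeasurable_left hf_meas (hf.integrable_mul hg)
      (hg.integrable one_le_two)).trans (EventuallyEq.rfl.mul hp)
  rw [covariance_eq_sub hf hg, covariance_eq_sub hf hpL2, ← integral_condExp hm,
    integral_congr_ae hpull, ← integral_condExp (f := g) hm, integral_congr_ae hp]

theorem variance_add_sum_of_uncorrelated [IsFiniteMeasure μ] {ι : Type*} [Fintype ι]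
    {Z : Ω → ℝ} {ξ : ι → Ω → ℝ} (hZ : MemLp Z 2 μ) (hξ : ∀ j, MemLp (ξ j) 2 μ)
    (hcross : ∀ j, cov[Z, ξ j; μ] = 0) (huncorr : Pairwise fun i j => cov[ξ i, ξ j; μ] = 0)
    (c : ι → ℝ) :
    Var[fun ω => Z ω + ∑ j, c j * ξ j ω; μ] = Var[Z; μ] + ∑ j, c j ^ 2 * Var[ξ j; μ] := by
  have hcξ : ∀ j, MemLp (fun ω => c j * ξ j ω) 2 μ := fun j => (hξ j).const_mul (c j)
  have hcov : cov[Z, fun ω => ∑ j, c j * ξ j ω; μ] = 0 := by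
    simp only [covariance_fun_sum_right hcξ hZ, covariance_const_mul_right, hcross, mul_zero,
      Finset.sum_const_zero]
  have hvar : Var[fun ω => ∑ j, c j * ξ j ω; μ] = ∑ j, c j ^ 2 * Var[ξ j; μ] := by
    rw [variance_fun_sum hcξ]
    refine Finset.sum_congr rfl fun i _ => ?_
    rw [Finset.sum_eq_single_of_mem i (Finset.mem_univ i) fun j _ hji => by
        rw [covariance_const_mul_left, covariance_const_mul_right, huncorr hji.symm, mul_zero,
          mul_zero],
      covariance_self (hcξ i).aemeasurable, variance_const_mul]
  rw [variance_fun_add hZ (memLp_finsetSum _ fun j _ => hcξ j), hcov, hvar, mul_zero, add_zero]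

theorem ae_tendsto_sub_integral_of_summable_variance [IsFiniteMeasure μ] {ξ : ℕ → Ω → ℝ}
    (hξ : ∀ t, MemLp (ξ t) 2 μ) (hsum : Summable fun t => Var[ξ t; μ]) :
    ∀ᵐ ω ∂μ, Tendsto (fun t => ξ t ω - μ[ξ t]) atTop (𝓝 0) := by
  have hmeas : ∀ t, AEMeasurable (fun ω => ENNReal.ofReal ((ξ t ω - μ[ξ t]) ^ 2)) μ := fun t =>
    (((hξ t).aemeasurable.sub_const _).pow_const 2).ennreal_ofReal
  have hlint : ∫⁻ ω, ∑' t, ENNReal.ofReal ((ξ t ω - μ[ξ t]) ^ 2) ∂μ ≠ ⊤ := by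
    simp only [lintegral_tsum hmeas, ← evariance_eq_lintegral_ofReal, ← ofReal_variance (hξ _)]
    exact hsum.tsum_ofReal_ne_top
  filter_upwards [ae_lt_top' (.tsum hmeas) hlint] with ω hω
  have habs := ((ENNReal.tendsto_toReal ENNReal.zero_ne_top).comp
    (ENNReal.tendsto_atTop_zero_of_tsum_ne_top hω.ne)).sqrt
  simp only [Function.comp_def, ENNReal.toReal_ofReal (sq_nonneg _), ENNReal.toReal_zero,
    Real.sqrt_zero, Real.sqrt_sq_eq_abs] at habs
  exact (tendsto_zero_iff_abs_tendsto_zero _).2 habs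

theorem exists_measurable_limit_mem [NeZero μ] {β : Type*} [TopologicalSpace β]
    [TopologicalSpace.MetrizableSpace β] [MeasurableSpace β] [BorelSpace β]
    {f : ℕ → Ω → β} (hf : ∀ t, Measurable (f t)) {S : Set β}
    (hlim : ∀ᵐ ω ∂μ, ∃ b ∈ S, Tendsto (fun t => f t ω) atTop (𝓝 b)) :
    ∃ g : Ω → β, Measurable g ∧ (∀ ω, g ω ∈ S) ∧
      ∀ᵐ ω ∂μ, Tendsto (fun t => f t ω) atTop (𝓝 (g ω)) := by
  obtain ⟨g₀, hg₀, hlim₀⟩ := measurable_limit_of_tendsto_metrizable_ae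
    (fun t => (hf t).aemeasurable) (hlim.mono fun _ ⟨b, _, hb⟩ => ⟨b, hb⟩)
  have hmem : ∀ᵐ ω ∂μ, g₀ ω ∈ S := by
    filter_upwards [hlim, hlim₀] with ω ⟨b, hbS, hb⟩ hω
    exact tendsto_nhds_unique hω hb ▸ hbS
  obtain ⟨g, hg, hgS, hgg₀⟩ :=
    hg₀.aemeasurable.exists_ae_eq_range_subset hmem (hmem.exists.imp' g₀ fun _ => id)
  refine ⟨g, hg, Set.range_subset_iff.1 hgS, ?_⟩
  filter_upwards [hlim₀, hgg₀] with ω hω heq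
  exact heq ▸ hω

end Probability

/-! ### Social samples -/

section Message

variable {M : ℕ}

theorem msgVec_injective : Function.Injective (msgVec (M := M)) := by
  rintro (_ | k) (_ | l) hkl
  · rfl
  · simpa [msgVec] using congrFun hkl l
  · simpa [msgVec] using congrFun hkl k
  · have hk := congrFun hkl k
    by_contra hne
    rw [msgVec, msgVec, Pi.single_eq_same,
      Pi.single_eq_of_ne fun h => hne (congrArg some h)] at hk
    exact one_ne_zero hk

theorem msgVec_binary (o : Option (Fin M)) (m : Fin M) : msgVec o m = 0 ∨ msgVec o m = 1 := by
  cases o with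
  | none => exact Or.inl rfl
  | some k => by_cases hm : m = k <;> simp [msgVec, hm]

theorem sum_msgVec_le_one (o : Option (Fin M)) : ∑ m, msgVec o m ≤ 1 := by
  cases o <;> simp [msgVec]

theorem sum_msgProb (p : Fin M → ℝ) : ∑ o, msgProb p o = 1 := by
  simp [Fintype.sum_option, msgProb]

theorem sum_msgProb_mul_msgVec (p : Fin M → ℝ) (m : Fin M) :
    ∑ o, msgProb p o * msgVec o m = p m := by
  simp [Fintype.sum_option, msgProb, msgVec, Pi.single_apply]

end Message

/-- The deviation `Y_{i,m}(t) - P_{i,m}(t)` of the messages from the distributions they are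
sampled from, as a random variable. -/
noncomputable def noise {n M : ℕ} {Ω : Type*} (P Y : ℕ → Ω → Matrix (Fin n) (Fin M) ℝ) (t : ℕ)
    (i : Fin n) (m : Fin M) (ω : Ω) : ℝ :=
  Y t ω i m - P t ω i m

namespace IsSocialSample

variable {n M : ℕ} {Ω : Type*} [mΩ : MeasurableSpace Ω] {μ : Measure Ω}
  {Q P Y : ℕ → Ω → Matrix (Fin n) (Fin M) ℝ}

theorem message_eq_zero_or_one (h : IsSocialSample μ Q P Y) (t : ℕ) (ω : Ω) (i : Fin n)
    (m : Fin M) : Y t ω i m = 0 ∨ Y t ω i m = 1 := by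
  obtain ⟨o, ho⟩ := h.mem_alphabet t ω i
  exact ho ▸ msgVec_binary o m

theorem message_mem_Icc (h : IsSocialSample μ Q P Y) (t : ℕ) (ω : Ω) (i : Fin n) (m : Fin M) :
    Y t ω i m ∈ Set.Icc 0 1 := by
  rcases h.message_eq_zero_or_one t ω i m with hY | hY <;> simp [hY]

theorem measurableSet_messages_eq (h : IsSocialSample μ Q P Y) (t : ℕ)
    (v : Fin n → Option (Fin M)) : MeasurableSet {ω | ∀ i, Y t ω i = msgVec (v i)} := by
  simp only [funext_iff, Set.ofPred_forall]
  exact MeasurableSet.iInter fun i => MeasurableSet.iInter fun m =>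
    h.measurable t i m (measurableSet_singleton _)

theorem prod_eq_sum_indicator (h : IsSocialSample μ Q P Y) (t : ℕ)
    (g : Fin n → (Fin M → ℝ) → ℝ) :
    (fun ω => ∏ i, g i (Y t ω i)) = ∑ v : Fin n → Option (Fin M), (∏ i, g i (msgVec (v i))) •
      {ω | ∀ i, Y t ω i = msgVec (v i)}.indicator fun _ => (1 : ℝ) := by
  classical
  funext ω
  choose v hv using fun i => h.mem_alphabet t ω i
  have hindicator : ∀ w : Fin n → Option (Fin M),
      {ω | ∀ i, Y t ω i = msgVec (w i)}.indicator (fun _ => (1 : ℝ)) ω =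
        if w = v then 1 else 0 := by
    intro w
    simp only [Set.indicator_apply, Set.mem_ofPred_eq, ← hv, msgVec_injective.eq_iff]
    simp only [funext_iff, eq_comm]
  simp only [Finset.sum_apply, Pi.smul_apply, hindicator, smul_eq_mul, mul_ite, mul_one, mul_zero,
    Finset.sum_ite_eq', Finset.mem_univ, if_true, hv]

theorem condExp_prod [IsFiniteMeasure μ] (h : IsSocialSample μ Q P Y) (t : ℕ)
    (g : Fin n → (Fin M → ℝ) → ℝ) :
    μ[fun ω => ∏ i, g i (Y t ω i) | history Q t] =ᵐ[μ]
      fun ω => ∏ i, ∑ o, msgProb (P t ω i) o * g i (msgVec o) := by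
  have hint : ∀ v : Fin n → Option (Fin M), Integrable ((∏ i, g i (msgVec (v i))) •
      {ω | ∀ i, Y t ω i = msgVec (v i)}.indicator fun _ => (1 : ℝ)) μ := fun v =>
    ((integrable_const 1).indicator (h.measurableSet_messages_eq t v)).smul _
  have hterm : ∀ᵐ ω ∂μ, ∀ v : Fin n → Option (Fin M),
      (μ[(∏ i, g i (msgVec (v i))) •
        {ω | ∀ i, Y t ω i = msgVec (v i)}.indicator (fun _ => (1 : ℝ)) | history Q t]) ω =
        (∏ i, g i (msgVec (v i))) * ∏ i, msgProb (P t ω i) (v i) := by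
    refine ae_all_iff.2 fun v => ?_
    filter_upwards [condExp_smul (μ := μ) (∏ i, g i (msgVec (v i)))
      ({ω | ∀ i, Y t ω i = msgVec (v i)}.indicator fun _ => (1 : ℝ)) (history Q t),
      h.law t v] with ω hsmul hlaw
    rw [hsmul, Pi.smul_apply, smul_eq_mul]
    exact congrArg _ hlaw
  rw [h.prod_eq_sum_indicator]
  refine (condExp_finsetSum (fun v _ => hint v) _).trans ?_
  filter_upwards [hterm] with ω hω
  rw [Finset.sum_apply, Finset.prod_univ_sum, Fintype.piFinset_univ]
  refine Finset.sum_congr rfl fun v _ => ?_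
  rw [hω, Finset.prod_mul_distrib, mul_comm]

theorem condExp_prod_message [IsFiniteMeasure μ] (h : IsSocialSample μ Q P Y) (t : ℕ) (m : Fin M)
    (s : Finset (Fin n)) :
    μ[fun ω => ∏ i ∈ s, Y t ω i m | history Q t] =ᵐ[μ] fun ω => ∏ i ∈ s, P t ω i m := by
  classical
  have hprod := h.condExp_prod t fun i y => if i ∈ s then y m else 1
  have hfactor : ∀ ω i, ∑ o, msgProb (P t ω i) o * (if i ∈ s then msgVec o m else 1) =
      if i ∈ s then P t ω i m else 1 := fun ω i => by
    split_ifs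
    · exact sum_msgProb_mul_msgVec _ m
    · simp only [mul_one, sum_msgProb]
  simpa only [hfactor, Finset.prod_ite_mem, Finset.univ_inter] using hprod

theorem condExp_message [IsFiniteMeasure μ] (h : IsSocialSample μ Q P Y) (t : ℕ) (i : Fin n)
    (m : Fin M) : μ[fun ω => Y t ω i m | history Q t] =ᵐ[μ] fun ω => P t ω i m := by
  simpa only [Finset.prod_singleton] using h.condExp_prod_message t m {i}

theorem condExp_message_mul [IsFiniteMeasure μ] (h : IsSocialSample μ Q P Y) (t : ℕ) {i j : Fin n}
    (hij : i ≠ j) (m : Fin M) :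
    μ[fun ω => Y t ω i m * Y t ω j m | history Q t] =ᵐ[μ] fun ω => P t ω i m * P t ω j m := by
  simpa only [Finset.prod_pair hij] using h.condExp_prod_message t m {i, j}

theorem memLp_message [IsFiniteMeasure μ] (h : IsSocialSample μ Q P Y) (t : ℕ) (i : Fin n)
    (m : Fin M) (p : ENNReal) : MemLp (fun ω => Y t ω i m) p μ :=
  memLp_of_bounded (Eventually.of_forall fun ω => h.message_mem_Icc t ω i m)
    (h.measurable t i m).aestronglyMeasurable p

theorem memLp_distribution [IsFiniteMeasure μ] (h : IsSocialSample μ Q P Y) (t : ℕ) (i : Fin n)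
    (m : Fin M) : MemLp (fun ω => P t ω i m) 2 μ :=
  ((h.memLp_message t i m 2).condExp one_le_two).ae_eq (h.condExp_message t i m)

theorem memLp_noise [IsFiniteMeasure μ] (h : IsSocialSample μ Q P Y) (t : ℕ) (i : Fin n)
    (m : Fin M) : MemLp (noise P Y t i m) 2 μ :=
  (h.memLp_message t i m 2).sub (h.memLp_distribution t i m)

theorem aestronglyMeasurable_distribution [IsFiniteMeasure μ] (h : IsSocialSample μ Q P Y) (t : ℕ)
    (i : Fin n) (m : Fin M) :
    AEStronglyMeasurable[history Q t] (fun ω => P t ω i m) μ :=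
  stronglyMeasurable_condExp.aestronglyMeasurable.congr (h.condExp_message t i m)

theorem integral_message [IsFiniteMeasure μ] (h : IsSocialSample μ Q P Y) {t : ℕ}
    (hle : history Q t ≤ mΩ) (i : Fin n) (m : Fin M) : ∫ ω, Y t ω i m ∂μ = ∫ ω, P t ω i m ∂μ := by
  rw [← integral_condExp hle, integral_congr_ae (h.condExp_message t i m)]

theorem integral_noise [IsFiniteMeasure μ] (h : IsSocialSample μ Q P Y) {t : ℕ}
    (hle : history Q t ≤ mΩ) (i : Fin n) (m : Fin M) : ∫ ω, noise P Y t i m ω ∂μ = 0 := by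
  simp only [noise]
  rw [integral_sub ((h.memLp_message t i m 2).integrable one_le_two)
    ((h.memLp_distribution t i m).integrable one_le_two), h.integral_message hle, sub_self]

theorem ae_tendsto_noise_of_summable [IsFiniteMeasure μ] (h : IsSocialSample μ Q P Y)
    (hle : ∀ t, history Q t ≤ mΩ) {i : Fin n} {m : Fin M}
    (hsum : Summable fun t => Var[noise P Y t i m; μ]) :
    ∀ᵐ ω ∂μ, Tendsto (fun t => noise P Y t i m ω) atTop (𝓝 0) := by
  simpa only [h.integral_noise (hle _), sub_zero] using
    ae_tendsto_sub_integral_of_summable_variance (fun t => h.memLp_noise t i m) hsum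

variable [IsProbabilityMeasure μ]

theorem covariance_message (h : IsSocialSample μ Q P Y) {t : ℕ} (hle : history Q t ≤ mΩ)
    {i j : Fin n} (hij : i ≠ j) (m : Fin M) :
    cov[fun ω => Y t ω i m, fun ω => Y t ω j m; μ] =
      cov[fun ω => P t ω i m, fun ω => P t ω j m; μ] := by
  have hmul : ∫ ω, Y t ω i m * Y t ω j m ∂μ = ∫ ω, P t ω i m * P t ω j m ∂μ := by
    rw [← integral_condExp hle, integral_congr_ae (h.condExp_message_mul t hij m)]
  simp only [covariance_eq_sub (h.memLp_message t _ m 2) (h.memLp_message t _ m 2),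
    covariance_eq_sub (h.memLp_distribution t _ m) (h.memLp_distribution t _ m), Pi.mul_apply, hmul,
    h.integral_message hle]

theorem covariance_noise_right (h : IsSocialSample μ Q P Y) {t : ℕ} (hle : history Q t ≤ mΩ)
    {Z : Ω → ℝ} (hZ_meas : AEStronglyMeasurable[history Q t] Z μ) (hZ : MemLp Z 2 μ) (i : Fin n)
    (m : Fin M) : cov[Z, noise P Y t i m; μ] = 0 := by
  have hY := h.memLp_message t i m 2
  exact (covariance_fun_sub_right hZ hY (h.memLp_distribution t i m)).trans
    (sub_eq_zero.2 (covariance_eq_of_condExp_ae_eq hle hZ_meas hZ hY (h.condExp_message t i m)))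

theorem covariance_noise_noise (h : IsSocialSample μ Q P Y) {t : ℕ} (hle : history Q t ≤ mΩ)
    {i j : Fin n} (hij : i ≠ j) (m : Fin M) :
    cov[noise P Y t i m, noise P Y t j m; μ] = 0 := by
  have hY := fun k => h.memLp_message t k m 2
  have hP := fun k => h.memLp_distribution t k m
  have hP_meas := fun k => h.aestronglyMeasurable_distribution t k m
  calc cov[noise P Y t i m, noise P Y t j m; μ]
      = cov[fun ω => Y t ω i m, noise P Y t j m; μ] -
          cov[fun ω => P t ω i m, noise P Y t j m; μ] :=
        covariance_fun_sub_left (hY i) (hP i) (h.memLp_noise t j m)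
    _ = cov[fun ω => Y t ω i m, noise P Y t j m; μ] := by
        rw [h.covariance_noise_right hle (hP_meas i) (hP i), sub_zero]
    _ = cov[fun ω => Y t ω i m, fun ω => Y t ω j m; μ] -
          cov[fun ω => Y t ω i m, fun ω => P t ω j m; μ] :=
        covariance_fun_sub_right (hY i) (hY j) (hP j)
    _ = 0 := by
        rw [h.covariance_message hle hij, covariance_comm (fun ω => Y t ω i m),
          covariance_eq_of_condExp_ae_eq hle (hP_meas j) (hP j) (hY i) (h.condExp_message t i m),
          covariance_comm, sub_self]

theorem variance_noise_eq_zero (h : IsSocialSample μ Q P Y) {t : ℕ} (hle : history Q t ≤ mΩ)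
    {i : Fin n} {m : Fin M} {c : ℝ} (hc : c = 0 ∨ c = 1) (hP : ∀ ω, P t ω i m = c) :
    Var[noise P Y t i m; μ] = 0 := by
  have hmean : ∫ ω, Y t ω i m ∂μ = c := by
    simp only [h.integral_message hle, hP, integral_const, probReal_univ, one_smul]
  have hvar : Var[noise P Y t i m; μ] = Var[fun ω => Y t ω i m; μ] := by
    unfold noise
    simp only [hP, variance_sub_const (h.measurable t i m).aestronglyMeasurable]
  have hle_zero := variance_le_sub_mul_sub (μ := μ)
    (Eventually.of_forall fun ω => h.message_mem_Icc t ω i m) (h.measurable t i m).aemeasurable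
  rw [hmean] at hle_zero
  rw [hvar]
  refine le_antisymm (hle_zero.trans_eq ?_) (variance_nonneg _ _)
  rcases hc with rfl | rfl <;> simp

end IsSocialSample

/-! ### Averaging with social samples -/

/-- The standing assumptions on the weights of an averaging scheme: `W` has nonnegative entries,
and `A` is the diagonal matrix of its row sums, none of which exceeds one. -/
structure IsWeighting {ι : Type*} [Fintype ι] (A W : Matrix ι ι ℝ) : Prop where
  nonneg : ∀ i j, 0 ≤ W i j
  isDiag : A.IsDiag
  sum_eq : ∀ i, ∑ j, W i j = A i i
  le_one : ∀ i, A i i ≤ 1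

namespace IsWeighting

variable {ι : Type*} [Fintype ι] {A W : Matrix ι ι ℝ} {G : SimpleGraph ι}

theorem apply_eq_zero (hw : IsWeighting A W) {i : ι} (hi : A i i = 0) (j : ι) : W i j = 0 :=
  (Finset.sum_eq_zero_iff_of_nonneg fun j _ => hw.nonneg i j).1 ((hw.sum_eq i).trans hi) j
    (Finset.mem_univ j)

theorem diag_eq_zero_of_vecMul_eq_zero (hw : IsWeighting A W)
    (hW_pos : ∀ i j, 0 < W i j ↔ G.Adj i j) {p : ι → ℝ} (hp : ∀ i, 0 < p i) {j : ι}
    (hj : (p ᵥ* W) j = 0) : A j j = 0 := by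
  have hcol : ∀ i, W i j = 0 := fun i =>
    (mul_eq_zero.1 ((Finset.sum_eq_zero_iff_of_nonneg fun i _ =>
      mul_nonneg (hp i).le (hw.nonneg i j)).1 hj i (Finset.mem_univ i))).resolve_left (hp i).ne'
  rw [← hw.sum_eq]
  refine Finset.sum_eq_zero fun i _ => ?_
  by_contra hne
  have hadj : G.Adj j i := (hW_pos j i).1 ((hw.nonneg j i).lt_of_ne' hne)
  exact ((hW_pos i j).2 hadj.symm).ne' (hcol i)

variable [DecidableEq ι]

theorem one_sub_apply_nonneg (hw : IsWeighting A W) (i j : ι) : 0 ≤ (1 - A) i j := by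
  rcases eq_or_ne i j with rfl | hij
  · simpa using hw.le_one i
  · simp [hij, hw.isDiag hij]

theorem mem_rowStochastic (hw : IsWeighting A W) :
    1 - A + W ∈ Matrix.rowStochastic ℝ ι := by
  refine Matrix.mem_rowStochastic_iff_sum.2
    ⟨fun i j => add_nonneg (hw.one_sub_apply_nonneg i j) (hw.nonneg i j), fun i => ?_⟩
  have hA : ∑ j, A i j = A i i :=
    Finset.sum_eq_single_of_mem i (Finset.mem_univ i) fun j _ hji => hw.isDiag hji.symm
  simp [Finset.sum_add_distrib, Finset.sum_sub_distrib, Matrix.one_apply, hA, hw.sum_eq]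

theorem apply_pos (hw : IsWeighting A W) {i j : ι} (hij : 0 < W i j) : 0 < (1 - A + W) i j :=
  add_pos_of_nonneg_of_pos (hw.one_sub_apply_nonneg i j) hij

theorem exists_diag_pos (hw : IsWeighting A W) (hA : ¬ ∀ i, A i i = 1) :
    ∃ i, 0 < (1 - A + W) i i := by
  obtain ⟨i, hi⟩ := not_forall.1 hA
  refine ⟨i, add_pos_of_pos_of_nonneg ?_ (hw.nonneg i i)⟩
  simpa using (hw.le_one i).lt_of_ne hi

theorem exists_pos_stationary (hw : IsWeighting A W) (hG : G.Connected)
    (hpos : ∀ ⦃i j⦄, G.Adj i j → 0 < W i j) :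
    ∃ p : ι → ℝ, (∀ i, 0 < p i) ∧ p ᵥ* (1 - A + W) = p := by
  have := hG.nonempty
  obtain ⟨p, hp, hp_ne, hpH⟩ := exists_nonneg_vecMul_eq hw.mem_rowStochastic
  exact ⟨p, pos_of_vecMul_eq hG.preconnected
    (fun i j => Matrix.nonneg_of_mem_rowStochastic hw.mem_rowStochastic)
    (fun i j hij => hw.apply_pos (hpos hij)) hp hp_ne hpH, hpH⟩

end IsWeighting

/-- The matrix of the expected estimates at time `t`. -/
noncomputable def meanEstimate {n M : ℕ} {Ω : Type*} [MeasurableSpace Ω] (μ : Measure Ω)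
    (Q : ℕ → Ω → Matrix (Fin n) (Fin M) ℝ) (t : ℕ) : Matrix (Fin n) (Fin M) ℝ :=
  Matrix.of fun i m => ∫ ω, Q t ω i m ∂μ

namespace IsAveraging

variable {n M : ℕ} {Ω : Type*} [mΩ : MeasurableSpace Ω] {μ : Measure Ω}
  {A W : Matrix (Fin n) (Fin n) ℝ} {X : Fin n → Fin M}
  {Q Y : ℕ → Ω → Matrix (Fin n) (Fin M) ℝ} {G : SimpleGraph (Fin n)}

theorem update_col (h : IsAveraging μ A W X Q Y) (t : ℕ) (ω : Ω) (m : Fin M) :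
    (Q (t + 1) ω).col m = (1 - A) *ᵥ (Q t ω).col m + W *ᵥ (Y t ω).col m := by
  rw [h.update]
  rfl

theorem update_row (h : IsAveraging μ A W X Q Y) (hA : A.IsDiag) (t : ℕ) (ω : Ω) (i : Fin n) :
    Q (t + 1) ω i = (1 - A i i) • Q t ω i + ∑ j, W i j • Y t ω j := by
  funext m
  have hAQ : (A * Q t ω) i m = A i i * Q t ω i m := by
    conv_lhs => rw [← hA.diagonal_diag, Matrix.diagonal_mul, Matrix.diag_apply]
  rw [h.update, Matrix.sub_mul, Matrix.one_mul, Matrix.add_apply, Matrix.sub_apply, hAQ]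
  simp only [Matrix.mul_apply, Pi.add_apply, Pi.smul_apply, Finset.sum_apply, smul_eq_mul, sub_mul,
    one_mul]

theorem estimate_mem_convexHull (h : IsAveraging μ A W X Q Y) (hw : IsWeighting A W) (t : ℕ) (ω : Ω)
    (i : Fin n) : Q t ω i ∈ convexHull ℝ (Set.range (msgVec (M := M))) := by
  induction t generalizing i with
  | zero =>
    rw [h.init]
    exact subset_convexHull ℝ _ ⟨some (X i), rfl⟩
  | succ t ih =>
    have hcomb : Q (t + 1) ω i = ∑ o : Option (Fin n),
        o.elim (1 - A i i) (W i) • o.elim (Q t ω i) (Y t ω) := by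
      simp only [Fintype.sum_option, Option.elim, h.update_row hw.isDiag]
    rw [hcomb]
    refine (convex_convexHull ℝ _).sum_mem ?_ ?_ ?_
    · rintro (_ | j) -
      exacts [sub_nonneg.2 (hw.le_one i), hw.nonneg i j]
    · simp only [Fintype.sum_option, Option.elim, hw.sum_eq, sub_add_cancel]
    · rintro (_ | j) -
      exacts [ih i, subset_convexHull ℝ _ (h.sample.mem_alphabet t ω j)]

theorem estimate_mem_Icc (h : IsAveraging μ A W X Q Y) (hw : IsWeighting A W) (t : ℕ) (ω : Ω)
    (i : Fin n) (m : Fin M) : Q t ω i m ∈ Set.Icc 0 1 := by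
  refine convexHull_min ?_ ((convex_Icc 0 1).linear_preimage (LinearMap.proj m))
    (h.estimate_mem_convexHull hw t ω i)
  rintro _ ⟨o, rfl⟩
  rcases msgVec_binary o m with ho | ho <;> simp [ho]

theorem sum_estimate_le_one (h : IsAveraging μ A W X Q Y) (hw : IsWeighting A W) (t : ℕ) (ω : Ω)
    (i : Fin n) : ∑ m, Q t ω i m ≤ 1 := by
  have hsub : Set.range msgVec ⊆ (∑ m, LinearMap.proj m : (Fin M → ℝ) →ₗ[ℝ] ℝ) ⁻¹' Set.Iic 1 := by
    rintro _ ⟨o, rfl⟩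
    simpa using sum_msgVec_le_one o
  simpa using convexHull_min hsub ((convex_Iic 1).linear_preimage _)
    (h.estimate_mem_convexHull hw t ω i)

theorem measurable_estimate (h : IsAveraging μ A W X Q Y) (t : ℕ) (i : Fin n) (m : Fin M) :
    Measurable fun ω => Q t ω i m := by
  induction t generalizing i with
  | zero => simp only [h.init, measurable_const]
  | succ t ih =>
    simp only [h.update, Matrix.add_apply, Matrix.mul_apply]
    exact (Finset.measurable_fun_sum _ fun j _ => (ih j).const_mul _).add
      (Finset.measurable_fun_sum _ fun j _ => (h.sample.measurable t j m).const_mul _)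

theorem history_le (h : IsAveraging μ A W X Q Y) (t : ℕ) : history Q t ≤ mΩ :=
  iSup_le fun s => Measurable.comap_le
    (measurable_pi_iff.2 fun i => measurable_pi_iff.2 fun m => h.measurable_estimate s i m)

theorem eq_single_of_diag_eq_zero (h : IsAveraging μ A W X Q Y) (hw : IsWeighting A W)
    {j : Fin n} (hj : A j j = 0) (t : ℕ) (ω : Ω) : Q t ω j = Pi.single (X j) 1 := by
  induction t with
  | zero => exact h.init ω j
  | succ t ih =>
    simp only [h.update_row hw.isDiag, hj, hw.apply_eq_zero hj, sub_zero, one_smul, zero_smul,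
      Finset.sum_const_zero, add_zero, ih]

theorem stationary_dotProduct_succ (h : IsAveraging μ A W X Q Y) {p : Fin n → ℝ}
    (hp : p ᵥ* (1 - A + W) = p) (t : ℕ) (ω : Ω) (m : Fin M) :
    p ⬝ᵥ (Q (t + 1) ω).col m =
      p ⬝ᵥ (Q t ω).col m + ∑ j, (p ᵥ* W) j * noise Q Y t j m ω := by
  rw [h.update_col, dotProduct_mulVec_add_mulVec hp]
  rfl

theorem memLp_dotProduct [IsFiniteMeasure μ] (h : IsAveraging μ A W X Q Y) (p : Fin n → ℝ) (t : ℕ)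
    (m : Fin M) : MemLp (fun ω => p ⬝ᵥ (Q t ω).col m) 2 μ :=
  memLp_finsetSum _ fun i _ => (h.sample.memLp_distribution t i m).const_mul (p i)

theorem aestronglyMeasurable_dotProduct [IsFiniteMeasure μ] (h : IsAveraging μ A W X Q Y)
    (p : Fin n → ℝ) (t : ℕ) (m : Fin M) :
    AEStronglyMeasurable[history Q t] (fun ω => p ⬝ᵥ (Q t ω).col m) μ := by
  simp only [dotProduct, Matrix.col_apply, ← Finset.sum_apply _ _ fun i ω => p i * Q t ω i m]
  exact Finset.sum_induction _ (AEStronglyMeasurable[history Q t] · μ) (fun _ _ => .add)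
    aestronglyMeasurable_zero fun i _ =>
      (h.sample.aestronglyMeasurable_distribution t i m).const_mul (p i)

theorem integrable_estimate [IsFiniteMeasure μ] (h : IsAveraging μ A W X Q Y) (t : ℕ) (i : Fin n)
    (m : Fin M) : Integrable (fun ω => Q t ω i m) μ :=
  (h.sample.memLp_distribution t i m).integrable one_le_two

theorem tendsto_meanEstimate [IsFiniteMeasure μ] (h : IsAveraging μ A W X Q Y)
    (hw : IsWeighting A W) {L : Ω → Matrix (Fin n) (Fin M) ℝ}
    (hlim : ∀ᵐ ω ∂μ, Tendsto (fun t => Q t ω) atTop (𝓝 (L ω))) (i : Fin n) (m : Fin M) :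
    Tendsto (fun t => meanEstimate μ Q t i m) atTop (𝓝 (∫ ω, L ω i m ∂μ)) := by
  refine tendsto_integral_of_dominated_convergence (fun _ => 1)
    (fun t => (h.measurable_estimate t i m).aestronglyMeasurable) (integrable_const 1)
    (fun t => Eventually.of_forall fun ω => ?_) ?_
  · have hQ := h.estimate_mem_Icc hw t ω i m
    rw [Real.norm_of_nonneg hQ.1]
    exact hQ.2
  · filter_upwards [hlim] with ω hω
    exact tendsto_pi_nhds.1 (tendsto_pi_nhds.1 hω i) m

variable [IsProbabilityMeasure μ]

theorem variance_stationary_dotProduct_succ (h : IsAveraging μ A W X Q Y) {p : Fin n → ℝ}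
    (hp : p ᵥ* (1 - A + W) = p) (t : ℕ) (m : Fin M) :
    Var[fun ω => p ⬝ᵥ (Q (t + 1) ω).col m; μ] = Var[fun ω => p ⬝ᵥ (Q t ω).col m; μ] +
      ∑ j, (p ᵥ* W) j ^ 2 * Var[noise Q Y t j m; μ] := by
  simp only [h.stationary_dotProduct_succ hp]
  exact variance_add_sum_of_uncorrelated (h.memLp_dotProduct p t m)
    (fun j => h.sample.memLp_noise t j m)
    (fun j => h.sample.covariance_noise_right (h.history_le t)
      (h.aestronglyMeasurable_dotProduct p t m) (h.memLp_dotProduct p t m) j m)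
    (fun i j hij => h.sample.covariance_noise_noise (h.history_le t) hij m) _

theorem variance_dotProduct_le (h : IsAveraging μ A W X Q Y) (hw : IsWeighting A W)
    (p : Fin n → ℝ) (t : ℕ) (m : Fin M) :
    Var[fun ω => p ⬝ᵥ (Q t ω).col m; μ] ≤ (∑ i, |p i|) ^ 2 := by
  have habs : ∀ ω, |p ⬝ᵥ (Q t ω).col m| ≤ ∑ i, |p i| := fun ω => by
    refine (Finset.abs_sum_le_sum_abs _ _).trans (Finset.sum_le_sum fun i _ => ?_)
    have hQ := h.estimate_mem_Icc hw t ω i m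
    rw [abs_mul, Matrix.col_apply, abs_of_nonneg hQ.1]
    exact mul_le_of_le_one_right (abs_nonneg _) hQ.2
  refine (variance_le_sq_of_bounded (Eventually.of_forall fun ω => abs_le.1 (habs ω))
    (h.memLp_dotProduct p t m).aemeasurable).trans_eq ?_
  ring

theorem summable_variance_noise (h : IsAveraging μ A W X Q Y) (hw : IsWeighting A W)
    {p : Fin n → ℝ} (hp : p ᵥ* (1 - A + W) = p) {j : Fin n} (hj : (p ᵥ* W) j ≠ 0) (m : Fin M) :
    Summable fun t => Var[noise Q Y t j m; μ] := by
  have hterm : ∀ t k, 0 ≤ (p ᵥ* W) k ^ 2 * Var[noise Q Y t k m; μ] := fun t k =>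
    mul_nonneg (sq_nonneg _) (variance_nonneg _ _)
  have hpartial : ∀ t, ∑ s ∈ Finset.range t, (p ᵥ* W) j ^ 2 * Var[noise Q Y s j m; μ] ≤
      Var[fun ω => p ⬝ᵥ (Q t ω).col m; μ] := fun t => by
    induction t with
    | zero => simp [variance_nonneg]
    | succ t ih =>
      rw [Finset.sum_range_succ, h.variance_stationary_dotProduct_succ hp]
      exact add_le_add ih
        (Finset.single_le_sum (fun k _ => hterm t k) (Finset.mem_univ j))
  exact (summable_mul_left_iff (pow_ne_zero 2 hj)).1 (summable_of_sum_range_le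
    (fun t => hterm t j) fun t => (hpartial t).trans (h.variance_dotProduct_le hw p t m))

theorem ae_tendsto_noise (h : IsAveraging μ A W X Q Y) (hw : IsWeighting A W)
    (hG : G.Connected) (hW_pos : ∀ i j, 0 < W i j ↔ G.Adj i j) :
    ∀ᵐ ω ∂μ, ∀ j m, Tendsto (fun t => noise Q Y t j m ω) atTop (𝓝 0) := by
  obtain ⟨p, hp_pos, hp⟩ := hw.exists_pos_stationary hG fun i j => (hW_pos i j).2
  refine ae_all_iff.2 fun j => ae_all_iff.2 fun m =>
    h.sample.ae_tendsto_noise_of_summable h.history_le ?_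
  by_cases hj : (p ᵥ* W) j = 0
  -- No agent listens to `j`, and so `j` listens to no agent: its messages are deterministic.
  · have hQ := h.eq_single_of_diag_eq_zero hw (hw.diag_eq_zero_of_vecMul_eq_zero hW_pos hp_pos hj)
    have hvar : ∀ t, Var[noise Q Y t j m; μ] = 0 := fun t =>
      h.sample.variance_noise_eq_zero (h.history_le t) (msgVec_binary (some (X j)) m)
        fun ω => congrFun (hQ t ω) m
    simp only [hvar, summable_zero]
  · exact h.summable_variance_noise hw hp hj m

theorem meanEstimate_zero (h : IsAveraging μ A W X Q Y) :
    meanEstimate μ Q 0 = Matrix.of fun i => Pi.single (X i) 1 := by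
  ext i m
  simp [meanEstimate, h.init]

theorem meanEstimate_succ (h : IsAveraging μ A W X Q Y) (t : ℕ) :
    meanEstimate μ Q (t + 1) = (1 - A + W) * meanEstimate μ Q t := by
  ext i m
  have hQ := fun j => (h.integrable_estimate t j m).const_mul ((1 - A) i j)
  have hY := fun j =>
    ((h.sample.memLp_message t j m 2).integrable one_le_two).const_mul (W i j)
  simp only [meanEstimate, h.update, Matrix.of_apply, Matrix.add_apply, Matrix.mul_apply, add_mul,
    Finset.sum_add_distrib]
  rw [integral_add (integrable_finsetSum _ fun j _ => hQ j)
      (integrable_finsetSum _ fun j _ => hY j),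
    integral_finsetSum _ fun j _ => hQ j, integral_finsetSum _ fun j _ => hY j]
  simp only [integral_const_mul, h.sample.integral_message (h.history_le t)]

theorem meanEstimate_mulVec_one (h : IsAveraging μ A W X Q Y) (hw : IsWeighting A W) (t : ℕ) :
    meanEstimate μ Q t *ᵥ 1 = 1 := by
  induction t with
  | zero =>
    funext i
    simp [h.meanEstimate_zero, Matrix.mulVec, dotProduct]
  | succ t ih =>
    rw [h.meanEstimate_succ, ← Matrix.mulVec_mulVec, ih,
      Matrix.one_vecMul_of_mem_rowStochastic hw.mem_rowStochastic]

theorem one_vecMul_meanEstimate (h : IsAveraging μ A W X Q Y) (hA : A.IsDiag)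
    (hbal : ∀ j, ∑ i, W i j = A j j) (t : ℕ) :
    1 ᵥ* meanEstimate μ Q t = (n : ℝ) • empirical X := by
  induction t with
  | zero =>
    funext m
    rcases eq_or_ne (n : ℝ) 0 with hn | hn
    · obtain rfl := Nat.cast_eq_zero.1 hn
      simp [Matrix.vecMul, dotProduct]
    · simp [h.meanEstimate_zero, Matrix.vecMul, dotProduct, empirical, Pi.single_apply, hn, eq_comm]
  | succ t ih =>
    rw [h.meanEstimate_succ, ← Matrix.vecMul_vecMul, one_vecMul_one_sub_add_of_balanced hA hbal, ih]

theorem ae_sum_estimate_eq_one (h : IsAveraging μ A W X Q Y) (hw : IsWeighting A W) :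
    ∀ᵐ ω ∂μ, ∀ t i, ∑ m, Q t ω i m = 1 := by
  refine ae_all_iff.2 fun t => ae_all_iff.2 fun i => ?_
  refine (integral_eq_iff_of_ae_le (integrable_finsetSum _ fun m _ => h.integrable_estimate t i m)
    (integrable_const 1) (Eventually.of_forall fun ω => h.sum_estimate_le_one hw t ω i)).1 ?_
  rw [integral_finsetSum _ fun m _ => h.integrable_estimate t i m]
  simpa [Matrix.mulVec, dotProduct, meanEstimate] using
    congrFun (h.meanEstimate_mulVec_one hw t) i

theorem ae_exists_tendsto (h : IsAveraging μ A W X Q Y) (hw : IsWeighting A W)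
    (hG : G.Connected) (hW_pos : ∀ i j, 0 < W i j ↔ G.Adj i j)
    (haper : ¬ (G.IsBipartite ∧ ∀ i, A i i = 1)) :
    ∀ᵐ ω ∂μ, ∃ k, Tendsto (fun t => Q t ω) atTop (𝓝 (consensus n (Pi.single k 1))) := by
  filter_upwards [h.ae_tendsto_noise hw hG hW_pos, h.ae_sum_estimate_eq_one hw] with ω hnoise hsum
  have hcol : ∀ m, ∃ b : ℝ, (b = 0 ∨ b = 1) ∧
      Tendsto (fun t => (Q t ω).col m) atTop (𝓝 fun _ => b) := fun m =>
    exists_tendsto_const_of_binary hG hw.mem_rowStochastic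
      (fun i j hij => hw.apply_pos ((hW_pos i j).2 hij))
      ((not_and_or.1 haper).imp_right hw.exists_diag_pos) (fun t => h.update_col t ω m)
      (fun t i => h.sample.message_eq_zero_or_one t ω i m) (tendsto_pi_nhds.2 fun i => hnoise i m)
  choose b hb hlim using hcol
  have hentry : ∀ i m, Tendsto (fun t => Q t ω i m) atTop (𝓝 (b m)) := fun i m =>
    tendsto_pi_nhds.1 (hlim m) i
  obtain ⟨i₀⟩ := hG.nonempty
  have hb_sum : ∑ m, b m = 1 :=
    tendsto_nhds_unique (tendsto_finsetSum Finset.univ fun m _ => hentry i₀ m)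
      (by simpa only [hsum] using tendsto_const_nhds)
  obtain ⟨k, hk⟩ := exists_eq_single_of_binary_of_sum_eq_one hb hb_sum
  exact ⟨k, tendsto_pi_nhds.2 fun i => tendsto_pi_nhds.2 fun m => hk ▸ hentry i m⟩

theorem exists_measurable_limit (h : IsAveraging μ A W X Q Y) (hw : IsWeighting A W)
    (hG : G.Connected) (hW_pos : ∀ i j, 0 < W i j ↔ G.Adj i j)
    (haper : ¬ (G.IsBipartite ∧ ∀ i, A i i = 1)) :
    ∃ q : Ω → Fin M → ℝ, Measurable q ∧ (∀ ω, ∃ m, q ω = Pi.single m 1) ∧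
      ∀ᵐ ω ∂μ, Tendsto (fun t => Q t ω) atTop (𝓝 (consensus n (q ω))) := by
  obtain ⟨i₀⟩ := hG.nonempty
  have hlim := h.ae_exists_tendsto hw hG hW_pos haper
  obtain ⟨q, hq, hq_mem, hq_lim⟩ := exists_measurable_limit_mem (μ := μ)
    (S := {v | ∃ m, v = Pi.single m 1})
    (fun t => measurable_pi_iff.2 fun m => h.measurable_estimate t i₀ m)
    (hlim.mono fun ω ⟨k, hk⟩ => ⟨Pi.single k 1, ⟨k, rfl⟩, tendsto_pi_nhds.1 hk i₀⟩)
  refine ⟨q, hq, hq_mem, ?_⟩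
  filter_upwards [hlim, hq_lim] with ω ⟨k, hk⟩ hω
  rwa [tendsto_nhds_unique hω (tendsto_pi_nhds.1 hk i₀)]

theorem integral_limit_eq_empirical [NeZero n] (h : IsAveraging μ A W X Q Y)
    (hw : IsWeighting A W) (hbal : ∀ j, ∑ i, W i j = A j j) {q : Ω → Fin M → ℝ}
    (hlim : ∀ᵐ ω ∂μ, Tendsto (fun t => Q t ω) atTop (𝓝 (consensus n (q ω)))) (m : Fin M) :
    ∫ ω, q ω m ∂μ = empirical X m := by
  have hmean := tendsto_finsetSum Finset.univ fun i _ => h.tendsto_meanEstimate hw hlim i m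
  have hcol : ∀ t, ∑ i, meanEstimate μ Q t i m = n * empirical X m := fun t => by
    simpa [Matrix.vecMul, dotProduct] using congrFun (h.one_vecMul_meanEstimate hw.isDiag hbal t) m
  simp only [hcol, consensus, Matrix.of_apply, Finset.sum_const, Finset.card_univ,
    Fintype.card_fin, nsmul_eq_mul] at hmean
  exact mul_left_cancel₀ (NeZero.ne (n : ℝ)) (tendsto_nhds_unique hmean tendsto_const_nhds)

end IsAveraging

end SocialSampling

theorem mainTheorem6 {n M : ℕ} {Ω : Type*} [MeasurableSpace Ω] (μ : Measure Ω)
    [IsProbabilityMeasure μ]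
    (G : SimpleGraph (Fin n)) (hG : G.Connected)
    (A W : Matrix (Fin n) (Fin n) ℝ)
    (hW_nonneg : ∀ i j, 0 ≤ W i j) (hW_pos : ∀ i j, 0 < W i j ↔ G.Adj i j)
    (hA_diag : A.IsDiag) (hA_sum : ∀ i, ∑ j, W i j = A i i) (hA_le : ∀ i, A i i ≤ 1)
    (h_aper : ¬ (G.IsBipartite ∧ ∀ i, A i i = 1))
    (X : Fin n → Fin M) (Q Y : ℕ → Ω → Matrix (Fin n) (Fin M) ℝ)
    (hQ : SocialSampling.IsAveraging μ A W X Q Y) :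
    ∃ q : Ω → Fin M → ℝ,
      Measurable q ∧
      (∀ ω, ∃ m : Fin M, q ω = Pi.single m 1) ∧
      (∀ᵐ ω ∂μ, Tendsto (fun t => Q t ω) atTop (𝓝 (SocialSampling.consensus n (q ω)))) ∧
      ((∀ j, ∑ i, W i j = A j j) →
        ∀ i m, Integrable (fun ω => SocialSampling.consensus n (q ω) i m) μ ∧
          ∫ ω, SocialSampling.consensus n (q ω) i m ∂μ =
            SocialSampling.consensus n (SocialSampling.empirical X) i m) := by
  have hw : SocialSampling.IsWeighting A W := ⟨hW_nonneg, hA_diag, hA_sum, hA_le⟩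
  obtain ⟨q, hq, hq_single, hlim⟩ := hQ.exists_measurable_limit hw hG hW_pos h_aper
  refine ⟨q, hq, hq_single, hlim, fun hbal i m => ⟨?_, ?_⟩⟩
  · refine Integrable.of_mem_Icc 0 1 (measurable_pi_iff.1 hq m).aemeasurable
      (Eventually.of_forall fun ω => ?_)
    obtain ⟨k, hk⟩ := hq_single ω
    by_cases hm : m = k <;> simp [SocialSampling.consensus, hk, hm]
  · have : NeZero n := ⟨(Fin.pos i).ne'⟩
    exact hQ.integral_limit_eq_empirical hw hbal hlim m
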